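/- Let $(X_i,T_i)$, $i\ge 1$, be i.i.d. pairs of real random variables such that $X_i$ and $T_i$ are independent and both take values in $[0,1]$ almost surely. Suppose that $X_i$ has distribution function $F$ and Lebesgue density $f$, and that $T_i$ has a Lebesgue density $q$ that is differentiable and strictly positive on $[0,1]$. Put $\Delta_i=1$ if $X_i\le T_i$ and $\Delta_i=0$ otherwise, and let $V_i=T_i+1$ if $\Delta_i=0$ and $V_i=T_i$ if $\Delta_i=1$. Let the kernel $w:\mathbb R\to\mathbb R$ be a continuously differentiable symmetric probability density with support contained in $[-1,1]$. For $h>0$ and $n\ge1$ put $$g_{nh}(y)=\frac1n\sum_{i=1}^n\frac1h\,w\Big(\frac{y-V_i}{h}\Big),\qquad g_{nh}'(y)=\frac1n\sum_{i=1}^n\frac1{h^2}\,w'\Big(\frac{y-V_i}{h}\Big),$$ $$f_{nh}^-(x)=\frac{1}{q(x)}g_{nh}'(x)-\frac{q'(x)}{q(x)^2}g_{nh}(x),\qquad f_{nh}^+(x)=-\Big(\frac{1}{q(x)}g_{nh}'(x+1)-\frac{q'(x)}{q(x)^2}g_{nh}(x+1)\Big),$$ and, for a fixed $t\in[0,1]$,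 $f_{nh}^t(x)=t f_{nh}^-(x)+(1-t)f_{nh}^+(x)$. Let $0<x<1$ and assume that $f$ is bounded on a neighbourhood of $x$. Let $h=h_n>0$ with $h\to0$ and $nh^3\to\infty$ as $n\to\infty$. Then $f^t_{nh}(x)$ is integrable for every $n$ and $$\sqrt{nh^3}\,\big(f_{nh}^t(x)-\mathrm E f_{nh}^t(x)\big)\ \xrightarrow{\ \mathcal D\ }\ N(0,\sigma_t^2),\qquad \sigma_t^2=\frac{1}{q(x)}\big(t^2F(x)+(1-t)^2(1-F(x))\big)\int w'(u)^2\,du,$$ where $N(0,0)$ denotes the point mass at $0$. -/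

import Mathlib

open MeasureTheory ProbabilityTheory

noncomputable section

namespace CurrentStatus

/-- The kernel condition: `w` is a continuously differentiable symmetric probability density
with support in `[-1, 1]`. -/
structure IsKernel (w : ℝ → ℝ) : Prop where
  contDiff : ContDiff ℝ 1 w
  symmetric : ∀ u, w (-u) = w u
  nonneg : ∀ u, 0 ≤ w u
  integral_eq_one : ∫ u, w u = 1
  support_subset : Function.support w ⊆ Set.Icc (-1) 1

/-- `f` is a probability density (with respect to Lebesgue measure) of the real random
variable `Y`. -/
structure HasDensity {Ω : Type*} [MeasurableSpace Ω] (P : Measure Ω) (Y : Ω → ℝ)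
    (f : ℝ → ℝ) : Prop where
  measurable : Measurable f
  nonneg : ∀ y, 0 ≤ f y
  map_eq : P.map Y = volume.withDensity (fun y => ENNReal.ofReal (f y))

/-- The univariate current status model: the pairs `(X i, T i)` are independent over `i`,
`X i` is independent of `T i`, every `X i` has density `f`, every `T i` has density `q`, both are
concentrated on `[0, 1]`, and `q` is differentiable and strictly positive on `[0, 1]`. -/
structure IsModel {Ω : Type*} [MeasurableSpace Ω] (P : Measure Ω) (X T : ℕ → Ω → ℝ)
    (f q : ℝ → ℝ) : Prop where
  measurable_X : ∀ i, Measurable (X i)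
  measurable_T : ∀ i, Measurable (T i)
  iIndep : iIndepFun (fun i ω => (X i ω, T i ω)) P
  indep : ∀ i, IndepFun (X i) (T i) P
  density_X : ∀ i, HasDensity P (X i) f
  density_T : ∀ i, HasDensity P (T i) q
  X_mem : ∀ i, ∀ᵐ ω ∂P, X i ω ∈ Set.Icc (0 : ℝ) 1
  T_mem : ∀ i, ∀ᵐ ω ∂P, T i ω ∈ Set.Icc (0 : ℝ) 1
  q_differentiable : DifferentiableOn ℝ q (Set.Icc 0 1)
  q_pos : ∀ y ∈ Set.Icc (0 : ℝ) 1, 0 < q y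

open Classical in
/-- The status indicator `Δ i = 1` if `X i ≤ T i` and `Δ i = 0` otherwise. -/
def status {Ω : Type*} (X T : ℕ → Ω → ℝ) (i : ℕ) (ω : Ω) : ℕ :=
  if X i ω ≤ T i ω then 1 else 0

/-- The transformed observations `V i = T i + 1` if `Δ i = 0` and `V i = T i` if `Δ i = 1`. -/
def transformed {Ω : Type*} (X T : ℕ → Ω → ℝ) (i : ℕ) (ω : Ω) : ℝ :=
  if status X T i ω = 0 then T i ω + 1 else T i ω

/-- The kernel density estimator `g_{nh}(y)` based on `v 0, …, v (n - 1)`. -/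
def kde (w : ℝ → ℝ) (n : ℕ) (h : ℝ) (v : ℕ → ℝ) (y : ℝ) : ℝ :=
  1 / n * ∑ i ∈ Finset.range n, 1 / h * w ((y - v i) / h)

/-- The derivative `g_{nh}'(y)` of the kernel density estimator. -/
def kdeDeriv (w : ℝ → ℝ) (n : ℕ) (h : ℝ) (v : ℕ → ℝ) (y : ℝ) : ℝ :=
  1 / n * ∑ i ∈ Finset.range n, 1 / h ^ 2 * deriv w ((y - v i) / h)

/-- The left estimator `f_{nh}^-(x)`. -/
def leftEst (w q : ℝ → ℝ) (n : ℕ) (h : ℝ) (v : ℕ → ℝ) (x : ℝ) : ℝ :=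
  1 / q x * kdeDeriv w n h v x - deriv q x / q x ^ 2 * kde w n h v x

/-- The right estimator `f_{nh}^+(x)`. -/
def rightEst (w q : ℝ → ℝ) (n : ℕ) (h : ℝ) (v : ℕ → ℝ) (x : ℝ) : ℝ :=
  -(1 / q x * kdeDeriv w n h v (x + 1) - deriv q x / q x ^ 2 * kde w n h v (x + 1))

/-- The combined estimator `f_{nh}^t(x) = t f_{nh}^-(x) + (1 - t) f_{nh}^+(x)`, as a random
variable, computed from the transformed current status data. -/
def combinedEst {Ω : Type*} (X T : ℕ → Ω → ℝ) (w q : ℝ → ℝ) (t : ℝ) (n : ℕ) (h x : ℝ)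
    (ω : Ω) : ℝ :=
  t * leftEst w q n h (fun i => transformed X T i ω) x
    + (1 - t) * rightEst w q n h (fun i => transformed X T i ω) x

/-- `σ_t² = (1 / q(x)) (t² F(x) + (1 - t)² (1 - F(x))) ∫ w'(u)² du`, for a distribution
function `F`. -/
def asymptoticVariance (w q F : ℝ → ℝ) (t x : ℝ) : ℝ :=
  1 / q x * (t ^ 2 * F x + (1 - t) ^ 2 * (1 - F x)) * ∫ u, deriv w u ^ 2

/-- `σ_t²` is nonnegative, so that nothing is lost in regarding it as an element of `ℝ≥0`. -/
theorem asymptoticVariance_nonneg (w q : ℝ → ℝ) (μ : Measure ℝ) (t x : ℝ) (hq : 0 ≤ q x) :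
    0 ≤ asymptoticVariance w q (cdf μ) t x := by
  have h0 := cdf_nonneg μ x
  have h1 : 0 ≤ 1 - cdf μ x := sub_nonneg.2 (cdf_le_one μ x)
  have h2 : 0 ≤ ∫ u, deriv w u ^ 2 := integral_nonneg fun u => sq_nonneg _
  unfold asymptoticVariance
  positivity

end CurrentStatus

end

noncomputable section

namespace CurrentStatus

open Filter Topology

/-! The estimator is an average of `h⁻² c(V i)`, where `c` is `contribution`. Hence `√(n h³)` times
its centred version equals `n^(-1/2)` times a sum of i.i.d. centred variables `h^(-1/2) (c(V i) - E
c)` (`standardized_sum_eq`). These are `O(h^(-1/2))`, which is `o(√n)` because `n h → ∞`, so a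
central limit theorem for bounded triangular arrays applies as soon as the variances converge.

Given `T = s`, the observation is `s` with probability `F(s)` and `s + 1` with probability `1 -
F(s)`. For `h < min(x, 1 - x)` the windows around `x` and `x + 1` see only the first and only the
second case respectively, so no cross term arises. Rescaling gives `E c^p = h ∫ r_p(x - h u)
K_h(u)^p du`, with `K_h → w' / q(x)` and `r_p = q (F t^p + (1 - F) (-(1 - t))^p)` continuous at `x`.
Thus `E c² / h → σ_t²`, while `(E c)² / h = O(h)` disappears. -/

/-! ### Central limit theorem for bounded triangular arrays -/

lemma norm_cexp_mul_I_sub_taylor_le {y : ℝ} (hy : |y| ≤ 1) :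
    ‖Complex.exp (y * Complex.I) - (1 + y * Complex.I - (y : ℂ) ^ 2 / 2)‖ ≤ |y| ^ 3 := by
  have hn : ‖(y : ℂ) * Complex.I‖ = |y| := by simp
  have h := Complex.exp_bound (x := y * Complex.I) (n := 3) (by rw [hn]; exact hy) (by norm_num)
  rw [hn] at h
  have hs : ∑ m ∈ Finset.range 3, ((y : ℂ) * Complex.I) ^ m / (m.factorial : ℂ)
      = 1 + y * Complex.I - (y : ℂ) ^ 2 / 2 := by
    simp [Finset.sum_range_succ, mul_pow, Nat.factorial]
    ring
  rw [hs] at h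
  refine h.trans ?_
  have h3 : (0 : ℝ) ≤ |y| ^ 3 := by positivity
  -- The constant from `Complex.exp_bound` is `4 / (3! * 3) = 2 / 9`, below `1`.
  norm_num [Nat.factorial]
  linarith

/-- Since `|Y|³ ≤ b Y²`, the Taylor remainder is controlled by the second moment and the sup bound
alone. -/
lemma norm_charFun_sub_taylor_le {Ω : Type*} [MeasurableSpace Ω] {P : Measure Ω}
    [IsProbabilityMeasure P] {Y : Ω → ℝ} (hY : Measurable Y) {b : ℝ} (hb : ∀ ω, |Y ω| ≤ b)
    (h0 : ∫ ω, Y ω ∂P = 0) {s : ℝ} (hs : |s| * b ≤ 1) :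
    ‖charFun (P.map Y) s - (1 - ((s ^ 2 * ∫ ω, Y ω ^ 2 ∂P : ℝ) : ℂ) / 2)‖
      ≤ |s| ^ 3 * b * ∫ ω, Y ω ^ 2 ∂P := by
  have hYint : Integrable Y P :=
    Integrable.of_bound hY.aestronglyMeasurable b (ae_of_all _ hb)
  have hY2int : Integrable (fun ω => Y ω ^ 2) P := by
    refine Integrable.of_bound (hY.pow_const 2).aestronglyMeasurable (b ^ 2) (ae_of_all _ ?_)
    intro ω
    rw [norm_pow, Real.norm_eq_abs]
    exact pow_le_pow_left₀ (abs_nonneg _) (hb ω) 2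
  have hexp : Integrable (fun ω => Complex.exp ((s * Y ω : ℝ) * Complex.I)) P := by
    refine Integrable.of_bound (Measurable.aestronglyMeasurable (by fun_prop)) 1 (ae_of_all _ ?_)
    intro ω
    rw [Complex.norm_exp_ofReal_mul_I]
  have hlin : Integrable (fun ω => ((s * Y ω : ℝ) : ℂ) * Complex.I) P :=
    ((hYint.const_mul s).ofReal).mul_const _
  have hquad : Integrable (fun ω => ((s * Y ω : ℝ) : ℂ) ^ 2 / 2) P := by
    have : Integrable (fun ω => ((s ^ 2 * Y ω ^ 2 : ℝ) : ℂ) / 2) P :=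
      ((hY2int.const_mul (s ^ 2)).ofReal (𝕜 := ℂ)).div_const 2
    refine this.congr (ae_of_all _ fun ω => ?_)
    push_cast
    ring
  have hcf : charFun (P.map Y) s = ∫ ω, Complex.exp ((s * Y ω : ℝ) * Complex.I) ∂P := by
    rw [charFun_apply_real, integral_map hY.aemeasurable
      (Measurable.aestronglyMeasurable (by fun_prop))]
    push_cast
    rfl
  have h1lin : Integrable (fun ω => (1 : ℂ) + ((s * Y ω : ℝ) : ℂ) * Complex.I) P :=
    (integrable_const _).add hlin
  have htaylor : Integrable
      (fun ω => 1 + ((s * Y ω : ℝ) : ℂ) * Complex.I - ((s * Y ω : ℝ) : ℂ) ^ 2 / 2) P :=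
    h1lin.sub hquad
  have hpoly : ∫ ω, (1 + ((s * Y ω : ℝ) : ℂ) * Complex.I - ((s * Y ω : ℝ) : ℂ) ^ 2 / 2) ∂P
      = 1 - ((s ^ 2 * ∫ ω, Y ω ^ 2 ∂P : ℝ) : ℂ) / 2 := by
    rw [integral_sub h1lin hquad, integral_add (integrable_const _) hlin, integral_mul_const,
      integral_complex_ofReal, integral_const_mul, h0, integral_div]
    have : ∀ ω, ((s * Y ω : ℝ) : ℂ) ^ 2 = ((s ^ 2 * Y ω ^ 2 : ℝ) : ℂ) := fun ω => by
      push_cast; ring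
    simp_rw [this]
    rw [integral_complex_ofReal, integral_const_mul]
    simp
  rw [hcf, ← hpoly, ← integral_sub hexp htaylor,
    ← integral_const_mul]
  refine norm_integral_le_of_norm_le (hY2int.const_mul _) (ae_of_all _ fun ω => ?_)
  have hle : |s * Y ω| ≤ 1 := by
    rw [abs_mul]
    exact (mul_le_mul_of_nonneg_left (hb ω) (abs_nonneg _)).trans hs
  refine (norm_cexp_mul_I_sub_taylor_le hle).trans ?_
  rw [abs_mul, mul_pow, mul_assoc, pow_succ |Y ω| 2, sq_abs, mul_comm b]
  gcongr
  exact hb ω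

/-- A central limit theorem for row-wise i.i.d., centered, bounded triangular arrays. -/
theorem tendstoInDistribution_inv_sqrt_mul_sum_of_bounded_rows {Ω : Type*} [MeasurableSpace Ω]
    {P : Measure Ω} [IsProbabilityMeasure P] {Y : ℕ → ℕ → Ω → ℝ}
    (hY : ∀ n k, Measurable (Y n k)) (hindep : ∀ n, iIndepFun (Y n) P)
    (hident : ∀ n k, IdentDistrib (Y n k) (Y n 0) P P) {b : ℕ → ℝ}
    (hb : ∀ n ω, |Y n 0 ω| ≤ b n) (hb0 : Tendsto (fun n : ℕ => (√(n : ℝ))⁻¹ * b n) atTop (𝓝 0))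
    (h0 : ∀ n, ∫ ω, Y n 0 ω ∂P = 0) {v : ℝ} (hv : 0 ≤ v)
    (h2 : Tendsto (fun n => ∫ ω, Y n 0 ω ^ 2 ∂P) atTop (𝓝 v)) :
    TendstoInDistribution (fun (n : ℕ) ω => (√(n : ℝ))⁻¹ * ∑ k ∈ Finset.range n, Y n k ω) atTop
      (id : ℝ → ℝ) (fun _ => P) (gaussianReal 0 v.toNNReal) where
  forall_aemeasurable n :=
    (Measurable.const_mul (Finset.measurable_sum _ fun k _ => hY n k) _).aemeasurable
  tendsto := by
    refine ProbabilityMeasure.tendsto_iff_tendsto_charFun.2 fun s => ?_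
    simp only [ProbabilityMeasure.coe_mk, Measure.map_id, charFun_gaussianReal]
    have hcf : ∀ n : ℕ, charFun (P.map (fun ω => (√(n : ℝ))⁻¹ * ∑ k ∈ Finset.range n, Y n k ω)) s
        = (1 + (charFun (P.map (Y n 0)) ((√(n : ℝ))⁻¹ * s) - 1)) ^ n := fun n => by
      rw [charFun_inv_sqrt_mul_sum (hindep n) (hident n), add_sub_cancel]
    simp_rw [hcf]
    -- It remains to show `n (φ_n(s / √n) - 1) → -v s² / 2`, where `φ_n` is the characteristic
    -- function of `Y n 0`.
    refine Complex.tendsto_one_add_pow_exp_of_tendsto ?_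
    have hmain : Tendsto (fun n => -((s ^ 2 * ∫ ω, Y n 0 ω ^ 2 ∂P : ℝ) : ℂ) / 2) atTop
        (𝓝 ((0 : ℝ) * s * Complex.I - v.toNNReal * s ^ 2 / 2)) := by
      have := ((h2.const_mul (s ^ 2)).ofReal.neg).div_const 2
      convert this using 2
      rw [Real.coe_toNNReal v hv]
      push_cast
      ring
    have herr : Tendsto (fun n : ℕ => |s| ^ 3 * ((√(n : ℝ))⁻¹ * b n) * ∫ ω, Y n 0 ω ^ 2 ∂P) atTop
        (𝓝 0) := by
      simpa using (hb0.const_mul (|s| ^ 3)).mul h2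
    have hsmall : ∀ᶠ n : ℕ in atTop, |s| * ((√(n : ℝ))⁻¹ * b n) ≤ 1 := by
      have : Tendsto (fun n : ℕ => |s| * ((√(n : ℝ))⁻¹ * b n)) atTop (𝓝 0) := by
        simpa using hb0.const_mul |s|
      exact this.eventually_le_const one_pos
    have hdiff : Tendsto (fun n : ℕ =>
        (n : ℂ) * (charFun (P.map (Y n 0)) ((√(n : ℝ))⁻¹ * s) - 1)
          - -((s ^ 2 * ∫ ω, Y n 0 ω ^ 2 ∂P : ℝ) : ℂ) / 2) atTop (𝓝 0) := by
      -- After multiplication by `n`, the cubic remainder `(|s| / √n)³ b` keeps one spare factor `b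
      -- / √n → 0`.
      refine squeeze_zero_norm' ?_ herr
      filter_upwards [hsmall, eventually_gt_atTop 0] with n hn hnpos
      have hn0 : (0 : ℝ) < n := Nat.cast_pos.2 hnpos
      have hr : 0 < √(n : ℝ) := Real.sqrt_pos.2 hn0
      have hrr : (√(n : ℝ))⁻¹ ^ 2 = (n : ℝ)⁻¹ := by rw [inv_pow, Real.sq_sqrt hn0.le]
      have hab : |(√(n : ℝ))⁻¹ * s| = (√(n : ℝ))⁻¹ * |s| := by
        rw [abs_mul, abs_of_pos (inv_pos.2 hr)]
      have key := norm_charFun_sub_taylor_le (P := P) (hY n 0) (hb n) (h0 n)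
        (s := (√(n : ℝ))⁻¹ * s) (by rw [hab]; linarith)
      rw [hab, mul_pow _ s, hrr] at key
      have heq : (n : ℂ) * (charFun (P.map (Y n 0)) ((√(n : ℝ))⁻¹ * s) - 1)
          - -((s ^ 2 * ∫ ω, Y n 0 ω ^ 2 ∂P : ℝ) : ℂ) / 2
          = n * (charFun (P.map (Y n 0)) ((√(n : ℝ))⁻¹ * s)
            - (1 - (((n : ℝ)⁻¹ * s ^ 2 * ∫ ω, Y n 0 ω ^ 2 ∂P : ℝ) : ℂ) / 2)) := by
        have : (n : ℂ) ≠ 0 := by exact_mod_cast hnpos.ne'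
        push_cast
        field_simp
        ring
      rw [heq, norm_mul, Complex.norm_natCast]
      refine (mul_le_mul_of_nonneg_left key hn0.le).trans_eq ?_
      have h3 : (√(n : ℝ))⁻¹ ^ 3 = (n : ℝ)⁻¹ * (√(n : ℝ))⁻¹ := by rw [pow_succ, hrr]
      rw [mul_pow, h3]
      field_simp
    simpa using hdiff.add hmain

/-! ### Kernel bounds and separation of the two windows -/

section Kernel

variable {w : ℝ → ℝ}

lemma IsKernel.measurable (hw : IsKernel w) : Measurable w :=
  hw.contDiff.continuous.measurable

lemma IsKernel.eq_zero (hw : IsKernel w) {u : ℝ} (hu : u ∉ Set.Icc (-1 : ℝ) 1) : w u = 0 := by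
  by_contra h
  exact hu (hw.support_subset h)

lemma IsKernel.deriv_eq_zero (hw : IsKernel w) {u : ℝ} (hu : u ∉ Set.Icc (-1 : ℝ) 1) :
    deriv w u = 0 := by
  by_contra h
  exact hu (closure_minimal hw.support_subset isClosed_Icc (support_deriv_subset h))

lemma IsKernel.exists_bound (hw : IsKernel w) : ∃ B, 0 ≤ B ∧ ∀ u, |w u| ≤ B ∧ |deriv w u| ≤ B := by
  obtain ⟨B₀, hB₀⟩ := (isCompact_Icc (a := (-1 : ℝ)) (b := 1)).exists_bound_of_continuousOn
    hw.contDiff.continuous.continuousOn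
  obtain ⟨B₁, hB₁⟩ := (isCompact_Icc (a := (-1 : ℝ)) (b := 1)).exists_bound_of_continuousOn
    (hw.contDiff.continuous_deriv le_rfl).continuousOn
  have h0 : 0 ≤ max B₀ B₁ :=
    le_max_of_le_left ((norm_nonneg _).trans (hB₀ 0 ⟨by norm_num, by norm_num⟩))
  refine ⟨max B₀ B₁, h0, fun u => ?_⟩
  by_cases hu : u ∈ Set.Icc (-1 : ℝ) 1
  · exact ⟨(hB₀ u hu).trans (le_max_left _ _), (hB₁ u hu).trans (le_max_right _ _)⟩
  · simpa [hw.eq_zero hu, hw.deriv_eq_zero hu] using h0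

/-- The kernel `w' / q(x) - h (q'(x) / q(x)²) w`, whose rescaling by `h` drives both estimators. -/
def scoreKernel (w q : ℝ → ℝ) (x h u : ℝ) : ℝ :=
  1 / q x * deriv w u - h * (deriv q x / q x ^ 2) * w u

/-- The contribution of an observation `v` to the combined estimator, up to normalization. -/
def contribution (w q : ℝ → ℝ) (t x h v : ℝ) : ℝ :=
  t * scoreKernel w q x h ((x - v) / h) - (1 - t) * scoreKernel w q x h ((x + 1 - v) / h)

variable {q : ℝ → ℝ}

lemma IsKernel.measurable_scoreKernel (hw : IsKernel w) (x h : ℝ) :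
    Measurable (scoreKernel w q x h) :=
  ((measurable_deriv w).const_mul _).sub (hw.measurable.const_mul _)

lemma IsKernel.measurable_contribution (hw : IsKernel w) (t x h : ℝ) :
    Measurable (contribution w q t x h) := by
  have := hw.measurable_scoreKernel (q := q) x h
  unfold contribution
  fun_prop

lemma IsKernel.scoreKernel_eq_zero (hw : IsKernel w) (x h : ℝ) {u : ℝ}
    (hu : u ∉ Set.Icc (-1 : ℝ) 1) : scoreKernel w q x h u = 0 := by
  simp [scoreKernel, hw.eq_zero hu, hw.deriv_eq_zero hu]

lemma abs_scoreKernel_le {B : ℝ} (hB : ∀ u, |w u| ≤ B ∧ |deriv w u| ≤ B) (x h u : ℝ) :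
    |scoreKernel w q x h u| ≤ |1 / q x| * B + |h| * |deriv q x / q x ^ 2| * B := by
  unfold scoreKernel
  refine (abs_sub _ _).trans ?_
  rw [abs_mul, abs_mul (h * _), abs_mul h]
  gcongr
  exacts [(hB u).2, (hB u).1]

lemma abs_contribution_le {B t : ℝ} (hB : ∀ u, |w u| ≤ B ∧ |deriv w u| ≤ B)
    (ht : t ∈ Set.Icc (0 : ℝ) 1) (x h v : ℝ) :
    |contribution w q t x h v| ≤ |1 / q x| * B + |h| * |deriv q x / q x ^ 2| * B := by
  have h1 := abs_scoreKernel_le (q := q) hB x h ((x - v) / h)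
  have h2 := abs_scoreKernel_le (q := q) hB x h ((x + 1 - v) / h)
  unfold contribution
  refine (abs_sub _ _).trans ?_
  rw [abs_mul, abs_mul, abs_of_nonneg ht.1, abs_of_nonneg (sub_nonneg.2 ht.2)]
  have h3 := mul_le_mul_of_nonneg_left h1 ht.1
  have h4 := mul_le_mul_of_nonneg_left h2 (sub_nonneg.2 ht.2)
  linarith

/-- As `s ≤ 1` and `h < x`, the point `s` is more than `h` away from `x + 1`. -/
lemma contribution_of_mem (hw : IsKernel w) (t : ℝ) {x h s : ℝ} (hh : 0 < h) (hx : h < x)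
    (hs : s ∈ Set.Icc (0 : ℝ) 1) :
    contribution w q t x h s = t * scoreKernel w q x h ((x - s) / h) := by
  have : (x + 1 - s) / h ∉ Set.Icc (-1 : ℝ) 1 := fun hmem => by
    have := (div_le_one hh).1 hmem.2
    linarith [hs.2]
  rw [contribution, hw.scoreKernel_eq_zero x h this, mul_zero, sub_zero]

/-- As `s ≥ 0` and `h < 1 - x`, the point `s + 1` is more than `h` away from `x`. -/
lemma contribution_add_one_of_mem (hw : IsKernel w) (t : ℝ) {x h s : ℝ} (hh : 0 < h)
    (hx : h < 1 - x) (hs : s ∈ Set.Icc (0 : ℝ) 1) :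
    contribution w q t x h (s + 1) = -(1 - t) * scoreKernel w q x h ((x - s) / h) := by
  have : (x - (s + 1)) / h ∉ Set.Icc (-1 : ℝ) 1 := fun hmem => by
    have := (le_div_iff₀ hh).1 hmem.1
    linarith [hs.1]
  rw [contribution, hw.scoreKernel_eq_zero x h this, add_sub_add_right_eq_sub]
  ring

end Kernel

/-! ### Localization of integrals at `x` -/

lemma integral_rescale (ρ r : ℝ → ℝ) (x : ℝ) {h : ℝ} (hh : 0 < h) :
    ∫ s, r s * ρ ((x - s) / h) = h * ∫ u, r (x - h * u) * ρ u := by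
  have h1 := Measure.integral_comp_mul_left (fun y => r (x - y) * ρ ((x - (x - y)) / h)) h
  have h2 := integral_sub_left_eq_self (fun s => r s * ρ ((x - s) / h)) volume x
  rw [h2, abs_of_pos (inv_pos.2 hh)] at h1
  have h3 : ∀ u, ρ ((x - (x - h * u)) / h) = ρ u := fun u => by
    congr 1
    field_simp
    ring
  simp_rw [h3] at h1
  rw [h1, smul_eq_mul, mul_inv_cancel_left₀ hh.ne']

/-- Dominated convergence: for small `h` only values of `r` near `x` enter, where continuity bounds
them by `|r x| + 1`; no global bound on `r` is needed. -/
lemma tendsto_integral_comp_sub_mul {r : ℝ → ℝ} {x : ℝ} (hr : Measurable r)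
    (hrx : ContinuousAt r x) {h : ℕ → ℝ} (hh : Tendsto h atTop (𝓝 0)) {ρ : ℕ → ℝ → ℝ}
    {ρ' : ℝ → ℝ} (hρm : ∀ n, Measurable (ρ n))
    (hρ0 : ∀ n, ∀ u ∉ Set.Icc (-1 : ℝ) 1, ρ n u = 0) {B : ℝ}
    (hρB : ∀ᶠ n in atTop, ∀ u, |ρ n u| ≤ B)
    (hρ : ∀ u, Tendsto (fun n => ρ n u) atTop (𝓝 (ρ' u))) :
    Tendsto (fun n => ∫ u, r (x - h n * u) * ρ n u) atTop (𝓝 (r x * ∫ u, ρ' u)) := by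
  rw [← integral_const_mul]
  refine tendsto_integral_filter_of_dominated_convergence
    ((Set.Icc (-1 : ℝ) 1).indicator fun _ => (|r x| + 1) * B) ?_ ?_ ?_ ?_
  · refine Eventually.of_forall fun n => Measurable.aestronglyMeasurable ?_
    exact (hr.comp (by fun_prop)).mul (hρm n)
  · obtain ⟨δ, hδ, hδr⟩ := Metric.continuousAt_iff.1 hrx 1 one_pos
    filter_upwards [hρB, (Metric.tendsto_nhds.1 hh) δ hδ] with n hn hnδ
    refine ae_of_all _ fun u => ?_
    by_cases hu : u ∈ Set.Icc (-1 : ℝ) 1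
    · rw [Set.indicator_of_mem hu, norm_mul]
      have hd : dist (x - h n * u) x < δ := by
        rw [Real.dist_eq, sub_sub_cancel_left, abs_neg, abs_mul]
        rw [Real.dist_eq, sub_zero] at hnδ
        exact (mul_le_of_le_one_right (abs_nonneg _) (abs_le.2 hu)).trans_lt hnδ
      have h1 := hδr hd
      rw [Real.dist_eq] at h1
      have h2 := abs_sub_abs_le_abs_sub (r (x - h n * u)) (r x)
      refine mul_le_mul ?_ (hn u) (norm_nonneg _) (by positivity)
      rw [Real.norm_eq_abs]
      linarith
    · rw [Set.indicator_of_notMem hu, hρ0 n u hu]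
      simp
  · exact (integrable_indicator_iff measurableSet_Icc).2
      (integrableOn_const (by simp))
  · refine ae_of_all _ fun u => Tendsto.mul ?_ (hρ u)
    refine hrx.tendsto.comp ?_
    simpa using (hh.mul_const u).const_sub x

/-- The observation `V` as a function of the pair `(X, T)`. -/
def observation (p : ℝ × ℝ) : ℝ := if p.1 ≤ p.2 then p.2 else p.2 + 1

lemma measurable_observation : Measurable observation :=
  Measurable.ite (measurableSet_le measurable_fst measurable_snd) measurable_snd
    (measurable_snd.add_const 1)

lemma transformed_eq {Ω : Type*} (X T : ℕ → Ω → ℝ) (i : ℕ) :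
    transformed X T i = fun ω => observation (X i ω, T i ω) := by
  ext ω
  by_cases h : X i ω ≤ T i ω <;> simp [transformed, status, observation, h]

/-! ### Law and moments of one observation -/

section Model

variable {Ω : Type*} [MeasurableSpace Ω] {P : Measure Ω} {X T : ℕ → Ω → ℝ} {f q : ℝ → ℝ}

lemma IsModel.measurable_transformed (hm : IsModel P X T f q) (i : ℕ) :
    Measurable (transformed X T i) := by
  rw [transformed_eq]
  exact measurable_observation.comp ((hm.measurable_X i).prodMk (hm.measurable_T i))

lemma IsModel.iIndepFun_transformed (hm : IsModel P X T f q) :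
    iIndepFun (transformed X T) P := by
  have := hm.iIndep.comp (fun _ => observation) fun _ => measurable_observation
  convert this using 2 with i
  exact transformed_eq X T i

variable [IsProbabilityMeasure P]

lemma IsModel.map_pair (hm : IsModel P X T f q) (i : ℕ) :
    P.map (fun ω => (X i ω, T i ω)) = (P.map (X i)).prod (P.map (T i)) :=
  (indepFun_iff_map_prod_eq_prod_map_map (hm.measurable_X i).aemeasurable
    (hm.measurable_T i).aemeasurable).1 (hm.indep i)

lemma IsModel.identDistrib_transformed (hm : IsModel P X T f q) (i : ℕ) :
    IdentDistrib (transformed X T i) (transformed X T 0) P P := by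
  have hpair : IdentDistrib (fun ω => (X i ω, T i ω)) (fun ω => (X 0 ω, T 0 ω)) P P :=
    { aemeasurable_fst := ((hm.measurable_X i).prodMk (hm.measurable_T i)).aemeasurable
      aemeasurable_snd := ((hm.measurable_X 0).prodMk (hm.measurable_T 0)).aemeasurable
      map_eq := by
        rw [hm.map_pair, hm.map_pair, (hm.density_X i).map_eq, (hm.density_X 0).map_eq,
          (hm.density_T i).map_eq, (hm.density_T 0).map_eq] }
  rw [transformed_eq, transformed_eq]
  exact hpair.comp measurable_observation

/-- A law with a density has no atoms, and the jump of the distribution function at `a` is the mass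
of `{a}`. -/
lemma IsModel.continuous_cdf (hm : IsModel P X T f q) : Continuous (cdf (P.map (X 0))) := by
  have : IsProbabilityMeasure (P.map (X 0)) :=
    Measure.isProbabilityMeasure_map (hm.measurable_X 0).aemeasurable
  refine continuous_iff_continuousAt.2 fun a => ?_
  rw [(monotone_cdf _).continuousAt_iff_leftLim_eq_rightLim, StieltjesFunction.rightLim_eq]
  have h0 : P.map (X 0) {a} = 0 := by
    rw [(hm.density_X 0).map_eq]
    exact withDensity_absolutelyContinuous _ _ (by simp)
  rw [← measure_cdf (P.map (X 0)), StieltjesFunction.measure_singleton,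
    ENNReal.ofReal_eq_zero] at h0
  exact le_antisymm ((monotone_cdf _).leftLim_le le_rfl) (by linarith)

/-- By independence and Fubini, `X` is integrated out first with `T = s` fixed. -/
lemma IsModel.integral_comp_transformed (hm : IsModel P X T f q) {ψ : ℝ → ℝ} (hψ : Measurable ψ)
    {B : ℝ} (hB : ∀ v, |ψ v| ≤ B) :
    ∫ ω, ψ (transformed X T 0 ω) ∂P = ∫ s, (cdf (P.map (X 0)) s * ψ s
      + (1 - cdf (P.map (X 0)) s) * ψ (s + 1)) ∂(P.map (T 0)) := by
  have : IsProbabilityMeasure (P.map (X 0)) :=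
    Measure.isProbabilityMeasure_map (hm.measurable_X 0).aemeasurable
  have : IsProbabilityMeasure (P.map (T 0)) :=
    Measure.isProbabilityMeasure_map (hm.measurable_T 0).aemeasurable
  have hcomp : Measurable (fun p => ψ (observation p)) := hψ.comp measurable_observation
  rw [transformed_eq, ← integral_map (f := fun p => ψ (observation p))
    ((hm.measurable_X 0).prodMk (hm.measurable_T 0)).aemeasurable hcomp.aestronglyMeasurable,
    hm.map_pair, integral_prod_symm _
      (Integrable.of_bound hcomp.aestronglyMeasurable B (ae_of_all _ fun p => hB _))]
  refine integral_congr_ae (ae_of_all _ fun s => ?_)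
  have hsplit : ∀ y, ψ (observation (y, s)) = (Set.Iic s).indicator (fun _ => ψ s - ψ (s + 1)) y
      + ψ (s + 1) := fun y => by
    by_cases h : y ≤ s <;> simp [observation, h]
  simp_rw [hsplit]
  rw [integral_add ((integrable_indicator_iff measurableSet_Iic).2 (integrableOn_const (by simp)))
    (integrable_const _), integral_indicator_const _ measurableSet_Iic, cdf_eq_real]
  simp only [integral_const, probReal_univ, smul_eq_mul]
  ring

/-- The `p`-th moment of the contribution of one observation. -/
lemma IsModel.integral_contribution_pow (hm : IsModel P X T f q) {w : ℝ → ℝ} (hw : IsKernel w)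
    {t : ℝ} (ht : t ∈ Set.Icc (0 : ℝ) 1) {x h : ℝ} (hh : 0 < h) (hx₀ : h < x) (hx₁ : h < 1 - x)
    (p : ℕ) :
    ∫ ω, contribution w q t x h (transformed X T 0 ω) ^ p ∂P
      = h * ∫ u, (fun s => q s * (cdf (P.map (X 0)) s * t ^ p
          + (1 - cdf (P.map (X 0)) s) * (-(1 - t)) ^ p)) (x - h * u)
        * scoreKernel w q x h u ^ p := by
  obtain ⟨B, -, hB⟩ := hw.exists_bound
  have hdens := hm.density_T 0
  rw [hm.integral_comp_transformed (ψ := fun v => contribution w q t x h v ^ p)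
    ((hw.measurable_contribution t x h).pow_const p)
    (B := (|1 / q x| * B + |h| * |deriv q x / q x ^ 2| * B) ^ p) fun v => by
      rw [abs_pow]
      exact pow_le_pow_left₀ (abs_nonneg _) (abs_contribution_le hB ht x h v) p]
  have hmem : ∀ᵐ s ∂(P.map (T 0)), s ∈ Set.Icc (0 : ℝ) 1 :=
    (ae_map_iff (hm.measurable_T 0).aemeasurable measurableSet_Icc).2 (hm.T_mem 0)
  rw [integral_congr_ae (g := fun s => (cdf (P.map (X 0)) s * t ^ p
      + (1 - cdf (P.map (X 0)) s) * (-(1 - t)) ^ p) * scoreKernel w q x h ((x - s) / h) ^ p)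
      (by
        filter_upwards [hmem] with s hs
        simp only [contribution_of_mem hw t hh hx₀ hs, contribution_add_one_of_mem hw t hh hx₁ hs,
          mul_pow]
        ring), hdens.map_eq,
    integral_withDensity_eq_integral_toReal_smul hdens.measurable.ennreal_ofReal
      (ae_of_all _ fun _ => ENNReal.ofReal_lt_top),
    ← integral_rescale (fun u => scoreKernel w q x h u ^ p)
      (fun s => q s * (cdf (P.map (X 0)) s * t ^ p
        + (1 - cdf (P.map (X 0)) s) * (-(1 - t)) ^ p)) x hh]
  refine integral_congr_ae (ae_of_all _ fun s => ?_)
  simp only [ENNReal.toReal_ofReal (hdens.nonneg s), smul_eq_mul, mul_assoc]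

/-- Used with `p = 1` for the mean and `p = 2` for the variance. The case `p = 0` is excluded
because `K_h^p` must vanish off `[-1, 1]`. -/
lemma IsModel.tendsto_integral_contribution_pow (hm : IsModel P X T f q) {w : ℝ → ℝ}
    (hw : IsKernel w) {t : ℝ} (ht : t ∈ Set.Icc (0 : ℝ) 1) {x : ℝ} (hx : x ∈ Set.Ioo (0 : ℝ) 1)
    {h : ℕ → ℝ} (hpos : ∀ n, 0 < h n) (h_zero : Tendsto h atTop (𝓝 0)) {p : ℕ} (hp : p ≠ 0) :
    Tendsto (fun n => (h n)⁻¹ * ∫ ω, contribution w q t x (h n) (transformed X T 0 ω) ^ p ∂P) atTop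
      (𝓝 (q x * (cdf (P.map (X 0)) x * t ^ p + (1 - cdf (P.map (X 0)) x) * (-(1 - t)) ^ p)
        * ∫ u, (1 / q x * deriv w u) ^ p)) := by
  obtain ⟨B, hB0, hB⟩ := hw.exists_bound
  have hF := hm.continuous_cdf
  have hFm := hF.measurable
  have hqm := (hm.density_T 0).measurable
  have hqx : ContinuousAt q x :=
    (hm.q_differentiable.differentiableAt (Icc_mem_nhds hx.1 hx.2)).continuousAt
  have hlim := tendsto_integral_comp_sub_mul (x := x)
    (r := fun s => q s * (cdf (P.map (X 0)) s * t ^ p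
      + (1 - cdf (P.map (X 0)) s) * (-(1 - t)) ^ p)) (by fun_prop)
    (hqx.mul (by fun_prop)) h_zero (ρ := fun n u => scoreKernel w q x (h n) u ^ p)
    (ρ' := fun u => (1 / q x * deriv w u) ^ p)
    (fun n => (hw.measurable_scoreKernel x (h n)).pow_const p)
    (fun n u hu => by simp [hw.scoreKernel_eq_zero x (h n) hu, hp])
    (B := (|1 / q x| * B + 1 * |deriv q x / q x ^ 2| * B) ^ p)
    (by
      filter_upwards [h_zero.eventually_le_const one_pos] with n hn u
      rw [abs_pow]
      refine pow_le_pow_left₀ (abs_nonneg _) ((abs_scoreKernel_le hB x (h n) u).trans ?_) p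
      rw [abs_of_pos (hpos n)]
      gcongr)
    (fun u => by
      refine Tendsto.pow ?_ p
      simpa [scoreKernel] using
        ((h_zero.mul_const (deriv q x / q x ^ 2)).mul_const (w u)).const_sub
          (1 / q x * deriv w u))
  refine hlim.congr' ?_
  -- The moment formula holds once `h < x` and `h < 1 - x`.
  filter_upwards [h_zero.eventually_lt_const hx.1,
    h_zero.eventually_lt_const (sub_pos.2 hx.2)] with n hn₀ hn₁
  rw [hm.integral_contribution_pow hw ht (hpos n) hn₀ hn₁, inv_mul_cancel_left₀ (hpos n).ne']

end Model

/-! ### Standardization of the estimator and its limit law -/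

lemma combinedEst_eq {Ω : Type*} (X T : ℕ → Ω → ℝ) (w q : ℝ → ℝ) (t : ℝ) (n : ℕ) {h : ℝ}
    (hh : h ≠ 0) (x : ℝ) (ω : Ω) :
    combinedEst X T w q t n h x ω = 1 / n * ∑ i ∈ Finset.range n,
      1 / h ^ 2 * contribution w q t x h (transformed X T i ω) := by
  have hsum : ∀ i, 1 / h ^ 2 * contribution w q t x h (transformed X T i ω)
      = t * (1 / q x * (1 / h ^ 2 * deriv w ((x - transformed X T i ω) / h))
          - deriv q x / q x ^ 2 * (1 / h * w ((x - transformed X T i ω) / h)))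
        + (1 - t) * -(1 / q x * (1 / h ^ 2 * deriv w ((x + 1 - transformed X T i ω) / h))
          - deriv q x / q x ^ 2 * (1 / h * w ((x + 1 - transformed X T i ω) / h))) := fun i => by
    have : 1 / h = 1 / h ^ 2 * h := by field_simp
    simp only [contribution, scoreKernel, this]
    ring
  simp_rw [hsum]
  rw [Finset.sum_add_distrib, ← Finset.mul_sum, ← Finset.mul_sum, Finset.sum_neg_distrib,
    Finset.sum_sub_distrib, Finset.sum_sub_distrib]
  simp only [combinedEst, leftEst, rightEst, kde, kdeDeriv, ← Finset.mul_sum]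
  ring

lemma sqrt_mul_pow_three (n : ℕ) {h : ℝ} (hh : 0 < h) :
    √(n * h ^ 3) * (1 / n * (1 / h ^ 2)) = (√(n : ℝ))⁻¹ * (√h)⁻¹ := by
  -- For `n = 0` both sides are `0`, since division by zero gives `0`.
  rcases Nat.eq_zero_or_pos n with rfl | hn
  · simp
  have hn0 : (0 : ℝ) < n := Nat.cast_pos.2 hn
  have h1 : √(n * h ^ 3) = √(n : ℝ) * (h * √h) := by
    rw [Real.sqrt_mul hn0.le, pow_succ, Real.sqrt_mul (by positivity), Real.sqrt_sq hh.le]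
  have hs := Real.sqrt_pos.2 hn0
  have hs' := Real.sqrt_pos.2 hh
  have h2 := Real.mul_self_sqrt hn0.le
  have h3 := Real.mul_self_sqrt hh.le
  rw [h1]
  field_simp
  rw [sq, sq, h2, h3, mul_comm]

/-- Once `h ≤ 1`, `n h ≥ n h³`, so `n h → ∞`. -/
lemma tendsto_inv_sqrt_mul_inv_sqrt {h : ℕ → ℝ} (hpos : ∀ n, 0 < h n)
    (h_zero : Tendsto h atTop (𝓝 0))
    (h_rate : Tendsto (fun n : ℕ => (n : ℝ) * h n ^ 3) atTop atTop) :
    Tendsto (fun n : ℕ => (√(n : ℝ))⁻¹ * (√(h n))⁻¹) atTop (𝓝 0) := by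
  have hnh : Tendsto (fun n : ℕ => (n : ℝ) * h n) atTop atTop := by
    refine tendsto_atTop_mono' _ ?_ h_rate
    filter_upwards [h_zero.eventually_le_const one_pos] with n hn
    refine mul_le_mul_of_nonneg_left ?_ (Nat.cast_nonneg n)
    exact pow_le_of_le_one (hpos n).le hn three_ne_zero
  refine (tendsto_inv_atTop_zero.comp (Real.tendsto_sqrt_atTop.comp hnh)).congr fun n => ?_
  simp only [Function.comp_apply]
  rw [Real.sqrt_mul (Nat.cast_nonneg n), mul_inv]

variable {Ω : Type*} [MeasurableSpace Ω] {P : Measure Ω} [IsProbabilityMeasure P]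
  {X T : ℕ → Ω → ℝ} {f q w : ℝ → ℝ}

lemma IsModel.integrable_contribution (hm : IsModel P X T f q) (hw : IsKernel w) {t : ℝ}
    (ht : t ∈ Set.Icc (0 : ℝ) 1) (x h : ℝ) (i : ℕ) :
    Integrable (fun ω => contribution w q t x h (transformed X T i ω)) P := by
  obtain ⟨B, -, hB⟩ := hw.exists_bound
  exact Integrable.of_bound
    ((hw.measurable_contribution t x h).comp (hm.measurable_transformed i)).aestronglyMeasurable
    _ (ae_of_all _ fun ω => abs_contribution_le hB ht x h _)

lemma IsModel.integrable_combinedEst (hm : IsModel P X T f q) (hw : IsKernel w) {t : ℝ}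
    (ht : t ∈ Set.Icc (0 : ℝ) 1) (n : ℕ) (x : ℝ) {h : ℝ} (hh : h ≠ 0) :
    Integrable (combinedEst X T w q t n h x) P := by
  rw [funext (combinedEst_eq X T w q t n hh x)]
  exact (integrable_finsetSum _ fun i _ =>
    (hm.integrable_contribution hw ht x h i).const_mul _).const_mul _

/-- The summands of the standardized estimator. -/
def standardized (P : Measure Ω) (X T : ℕ → Ω → ℝ) (w q : ℝ → ℝ) (t x h : ℝ) (i : ℕ) (ω : Ω) : ℝ :=
  (√h)⁻¹ * (contribution w q t x h (transformed X T i ω)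
    - ∫ ω', contribution w q t x h (transformed X T 0 ω') ∂P)

lemma IsModel.standardized_sum_eq (hm : IsModel P X T f q) (hw : IsKernel w) {t : ℝ}
    (ht : t ∈ Set.Icc (0 : ℝ) 1) (n : ℕ) (x : ℝ) {h : ℝ} (hh : 0 < h) (ω : Ω) :
    √(n * h ^ 3) * (combinedEst X T w q t n h x ω - ∫ ω', combinedEst X T w q t n h x ω' ∂P)
      = (√(n : ℝ))⁻¹ * ∑ i ∈ Finset.range n, standardized P X T w q t x h i ω := by
  have hmean : ∀ i, ∫ ω', contribution w q t x h (transformed X T i ω') ∂P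
      = ∫ ω', contribution w q t x h (transformed X T 0 ω') ∂P := fun i =>
    ((hm.identDistrib_transformed i).comp (hw.measurable_contribution t x h)).integral_eq
  have hint : ∫ ω', combinedEst X T w q t n h x ω' ∂P = 1 / n * ∑ i ∈ Finset.range n,
      1 / h ^ 2 * ∫ ω', contribution w q t x h (transformed X T 0 ω') ∂P := by
    simp_rw [combinedEst_eq X T w q t n hh.ne' x]
    rw [integral_const_mul, integral_finsetSum _ fun i _ =>
      (hm.integrable_contribution hw ht x h i).const_mul _]
    simp_rw [integral_const_mul, hmean]
  rw [hint, combinedEst_eq X T w q t n hh.ne' x, ← mul_sub, ← Finset.sum_sub_distrib]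
  simp_rw [standardized, ← mul_sub, ← Finset.mul_sum]
  rw [← mul_assoc, ← mul_assoc, ← mul_assoc, mul_assoc √(n * h ^ 3), sqrt_mul_pow_three n hh]

lemma IsModel.tendsto_integral_standardized_sq (hm : IsModel P X T f q) (hw : IsKernel w) {t : ℝ}
    (ht : t ∈ Set.Icc (0 : ℝ) 1) {x : ℝ} (hx : x ∈ Set.Ioo (0 : ℝ) 1) {h : ℕ → ℝ}
    (hpos : ∀ n, 0 < h n) (h_zero : Tendsto h atTop (𝓝 0)) :
    Tendsto (fun n => ∫ ω, standardized P X T w q t x (h n) 0 ω ^ 2 ∂P) atTop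
      (𝓝 (asymptoticVariance w q (cdf (P.map (X 0))) t x)) := by
  have hq := hm.q_pos x ⟨hx.1.le, hx.2.le⟩
  have h1 := hm.tendsto_integral_contribution_pow hw ht hx hpos h_zero one_ne_zero
  have h2 := hm.tendsto_integral_contribution_pow hw ht hx hpos h_zero two_ne_zero
  -- The variance divided by `h` is `E c² / h - h (E c / h)²`, and `E c / h` converges.
  have hsq := h2.sub (h_zero.mul (h1.pow 2))
  have hlim : q x * (cdf (P.map (X 0)) x * t ^ 2 + (1 - cdf (P.map (X 0)) x) * (-(1 - t)) ^ 2)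
        * ∫ u, (1 / q x * deriv w u) ^ 2 = asymptoticVariance w q (cdf (P.map (X 0))) t x := by
    simp_rw [mul_pow, integral_const_mul, asymptoticVariance]
    field_simp
  rw [zero_mul, sub_zero, hlim] at hsq
  refine hsq.congr fun n => ?_
  have hi := hm.integrable_contribution hw ht x (h n) 0
  have hmem : MemLp (fun ω => contribution w q t x (h n) (transformed X T 0 ω)) 2 P := by
    obtain ⟨B, -, hB⟩ := hw.exists_bound
    exact MemLp.of_bound hi.aestronglyMeasurable _
      (ae_of_all _ fun ω => abs_contribution_le hB ht x (h n) _)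
  have hvar := variance_eq_sub hmem
  rw [variance_eq_integral hi.aemeasurable] at hvar
  simp_rw [standardized, mul_pow, integral_const_mul, hvar, inv_pow, Real.sq_sqrt (hpos n).le]
  simp only [pow_one, Pi.pow_apply]
  have := (hpos n).ne'
  field_simp

/-- Asymptotic normality of the combined estimator. -/
theorem IsModel.tendstoInDistribution_combinedEst (hm : IsModel P X T f q) (hw : IsKernel w)
    {t : ℝ} (ht : t ∈ Set.Icc (0 : ℝ) 1) {x : ℝ} (hx : x ∈ Set.Ioo (0 : ℝ) 1) {h : ℕ → ℝ}
    (hpos : ∀ n, 0 < h n) (h_zero : Tendsto h atTop (𝓝 0))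
    (h_rate : Tendsto (fun n : ℕ => (n : ℝ) * h n ^ 3) atTop atTop) :
    TendstoInDistribution
      (fun (n : ℕ) (ω : Ω) => √((n : ℝ) * h n ^ 3) * (combinedEst X T w q t n (h n) x ω
          - ∫ ω', combinedEst X T w q t n (h n) x ω' ∂P))
      atTop (id : ℝ → ℝ) (fun _ => P)
      (gaussianReal 0 (asymptoticVariance w q (cdf (P.map (X 0))) t x).toNNReal) := by
  simp_rw [fun n ω => hm.standardized_sum_eq hw ht n x (hpos n) ω]
  obtain ⟨B, -, hB⟩ := hw.exists_bound
  have hcm : ∀ n, Measurable fun v => (√(h n))⁻¹ * (contribution w q t x (h n) v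
      - ∫ ω', contribution w q t x (h n) (transformed X T 0 ω') ∂P) := fun n =>
    ((hw.measurable_contribution t x (h n)).sub_const _).const_mul _
  refine tendstoInDistribution_inv_sqrt_mul_sum_of_bounded_rows
    (Y := fun n => standardized P X T w q t x (h n))
    (b := fun n => (√(h n))⁻¹ * (2 * (|1 / q x| * B + |h n| * |deriv q x / q x ^ 2| * B)))
    (fun n k => (hcm n).comp (hm.measurable_transformed k))
    (fun n => hm.iIndepFun_transformed.comp _ fun _ => hcm n)
    (fun n k => (hm.identDistrib_transformed k).comp (hcm n)) (fun n ω => ?_) ?_ (fun n => ?_)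
    (asymptoticVariance_nonneg _ _ _ _ _ (hm.q_pos x ⟨hx.1.le, hx.2.le⟩).le)
    (hm.tendsto_integral_standardized_sq hw ht hx hpos h_zero)
  · have hmean : |∫ ω', contribution w q t x (h n) (transformed X T 0 ω') ∂P|
        ≤ |1 / q x| * B + |h n| * |deriv q x / q x ^ 2| * B := by
      simpa using norm_integral_le_of_norm_le_const (μ := P)
        (f := fun ω => contribution w q t x (h n) (transformed X T 0 ω))
        (ae_of_all _ fun ω => abs_contribution_le hB ht x (h n) (transformed X T 0 ω))
    rw [standardized, abs_mul, abs_of_nonneg (inv_nonneg.2 (Real.sqrt_nonneg _)), two_mul]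
    refine mul_le_mul_of_nonneg_left ?_ (inv_nonneg.2 (Real.sqrt_nonneg _))
    exact (abs_sub _ _).trans (add_le_add (abs_contribution_le hB ht x (h n) _) hmean)
  -- The row bound over `√n` is `(n h)^(-1/2)` times a convergent factor.
  · have hbd := (((h_zero.abs.mul_const |deriv q x / q x ^ 2|).mul_const B).const_add
      (|1 / q x| * B)).const_mul 2
    simpa [mul_assoc] using (tendsto_inv_sqrt_mul_inv_sqrt hpos h_zero h_rate).mul hbd
  · simp_rw [standardized]
    rw [integral_const_mul, integral_sub (hm.integrable_contribution hw ht x (h n) 0)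
      (integrable_const _)]
    simp

end CurrentStatus

end

theorem mainTheorem3 {Ω : Type*} [MeasurableSpace Ω] (P : Measure Ω) [IsProbabilityMeasure P]
    (X T : ℕ → Ω → ℝ) (f q w : ℝ → ℝ) (hmodel : CurrentStatus.IsModel P X T f q)
    (hw : CurrentStatus.IsKernel w)
    (x : ℝ) (hx : x ∈ Set.Ioo (0 : ℝ) 1)
    (hf : ∃ U ∈ nhds x, ∃ M : ℝ, ∀ y ∈ U, f y ≤ M)
    (t : ℝ) (ht : t ∈ Set.Icc (0 : ℝ) 1)
    (h : ℕ → ℝ) (hpos : ∀ n, 0 < h n)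
    (h_zero : Filter.Tendsto h Filter.atTop (nhds 0))
    (h_rate : Filter.Tendsto (fun n : ℕ => (n : ℝ) * h n ^ 3) Filter.atTop Filter.atTop) :
    (∀ n, Integrable (CurrentStatus.combinedEst X T w q t n (h n) x) P) ∧
    TendstoInDistribution
      (fun (n : ℕ) (ω : Ω) => Real.sqrt ((n : ℝ) * h n ^ 3) *
        (CurrentStatus.combinedEst X T w q t n (h n) x ω
          - ∫ ω', CurrentStatus.combinedEst X T w q t n (h n) x ω' ∂P))
      Filter.atTop (id : ℝ → ℝ) (fun _ => P)
      (gaussianReal 0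
        (CurrentStatus.asymptoticVariance w q (cdf (P.map (X 0))) t x).toNNReal) := by
  exact ⟨fun n => hmodel.integrable_combinedEst hw ht n x (hpos n).ne',
    hmodel.tendstoInDistribution_combinedEst hw ht hx hpos h_zero h_rate⟩
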